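/- Let $f\in C^\infty(\mathbb R)$ satisfy $f\ge 0$ and $f(x)\to 0$ as $|x|\to\infty$, and let $f'$ and $f''$ be bounded. Let $h\in C^\infty(\mathbb R)$ and $0<T\le\infty$, and let $u:[0,T)\times\mathbb R\to\mathbb R$ be a classical solution of $$u_t=u_{xx}-2f(x)\,u-u^2,\qquad u(0,x)=h(x),$$ that is, $u$ is continuous on $[0,T)\times\mathbb R$, the derivatives $u_t,u_x,u_{xx}$ exist and are continuous on $(0,T)\times\mathbb R$, and the equation holds there. Suppose that $u\le 0$ and that $u(s,\cdot)$ is bounded for each $s\in[0,T)$. Let $w\ge 0$ be a classical solution on $(0,\infty)\times\mathbb R$ (with $w_t,w_x,w_{xx}$ continuous) of the linearized equation $$w_t=w_{xx}-2f(x)\,w .$$ Its initial value may be a function or a measure; no condition is imposed at time $0$. Let $0<t<T$ and suppose that $w(t,\cdot)\in L^1(\mathbb R)$. Then $w(s,\cdot)\in L^1(\mathbb R)$ for all $0<s\le t$, the function $w(t,\cdot)\,h$ is integrable on $\mathbb R$, the function $s\mapsto 1/\|w(s,\cdot)\|_{L^1(\mathbb R)}$ is integrable on $(0,t)$, and $$-\int_{\mathbb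 R} w(t,x)\,h(x)\,dx\;\le\;\left(\int_0^t\frac{1}{\|w(s,\cdot)\|_{L^1(\mathbb R)}}\,ds\right)^{-1}.$$ (If $w\equiv 0$ on $(0,t]$, the quotients $1/0$ are read as $0$, and the inequality is $0\le 0$.) -/

import Mathlib

open Set MeasureTheory Filter Topology
open scoped ContDiff

/-- `u` is of class `C^{1,2}` on `I × ℝ` (for an open set of times `I`; `u s x` is the value at
time `s` and position `x`): `u_t`, `u_x` and `u_xx` exist and are jointly continuous there. -/
structure IsC12On (I : Set ℝ) (u : ℝ → ℝ → ℝ) : Prop where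
  differentiable_time : ∀ s ∈ I, ∀ x, DifferentiableAt ℝ (fun r => u r x) s
  differentiable_space : ∀ s ∈ I, Differentiable ℝ (u s)
  differentiable_space_deriv : ∀ s ∈ I, Differentiable ℝ (deriv (u s))
  continuousOn_time_deriv :
    ContinuousOn (fun p : ℝ × ℝ => deriv (fun r => u r p.2) p.1) (I ×ˢ univ)
  continuousOn_space_deriv :
    ContinuousOn (fun p : ℝ × ℝ => deriv (u p.1) p.2) (I ×ˢ univ)
  continuousOn_space_deriv_deriv :
    ContinuousOn (fun p : ℝ × ℝ => deriv (deriv (u p.1)) p.2) (I ×ˢ univ)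

/-- `u` is a classical solution on `[0, T) × ℝ` of the Cauchy problem
`u_t = u_xx - 2 f u - u ^ 2`, `u(0, ·) = h`; the lifespan `T` may be `⊤`. -/
structure IsClassicalSolution (f h : ℝ → ℝ) (T : EReal) (u : ℝ → ℝ → ℝ) : Prop where
  continuousOn : ContinuousOn (fun p : ℝ × ℝ => u p.1 p.2) ({s : ℝ | 0 ≤ s ∧ (s : EReal) < T} ×ˢ univ)
  isC12On : IsC12On {s : ℝ | 0 < s ∧ (s : EReal) < T} u
  equation : ∀ s : ℝ, 0 < s → (s : EReal) < T → ∀ x : ℝ,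
    deriv (fun r => u r x) s = deriv (deriv (u s)) x - 2 * f x * u s x - u s x ^ 2
  initial : ∀ x : ℝ, u 0 x = h x

/-- `w` is a classical solution of the linear equation `w_t = w_xx - 2 f w` on `(0, ∞) × ℝ`.
Nothing is required at time `0`, so that the initial value may be a function or a measure. -/
structure IsLinearSolution (f : ℝ → ℝ) (w : ℝ → ℝ → ℝ) : Prop where
  isC12On : IsC12On (Ioi 0) w
  equation : ∀ s : ℝ, 0 < s → ∀ x : ℝ,
    deriv (fun r => w r x) s = deriv (deriv (w s)) x - 2 * f x * w s x

/-! Put `q = -u ≥ 0`, so `q_t = q_xx - 2fq + q²`, and pair it with the time-reversed solution `p(s)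
= w(t - s)`, which solves the adjoint equation. Formally `φ(s) = ∫ p q` satisfies `φ' = ∫ p q²`,
which by Cauchy-Schwarz is at least `φ² / m(t - s)`, where `m` is the mass of `w`. Integrating
`(-1/φ)' ≥ 1/m(t - s)` gives `1/φ(0) ≥ ∫ 1/m`, which is the claim since `φ(0) = -∫ w(t) h`.

Nothing is known about `w_x`, `u_x`, or bounds on `u` uniform in time, so the pairing is regularised
twice: by a cutoff `c` on `[-R, R]`, and by replacing `q` with `G(q) = q / (1 + d q)`. Since `G` is
concave with `G(0) = 0`, the potential contributes with a favourable sign; `G' q² = G²` preserves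
the quadratic structure; and `-G'' q_x²` absorbs the cross term `c' G' q_x`. The remaining error is
at most `16 m / (d R²)` (`sat_energy_pointwise`, `le_integral_sat_energy`).

This needs a bound on `m` over `(0, t]`, which follows from a backward Gronwall estimate for the
localised mass (`exists_integral_le`). A Riccati lemma tolerating a small error
(`integral_le_inv_add_of_sq_le_deriv`) then allows `R → ∞`, after which `d → 0` and the final time
tends to `t`. -/

/-! ### Parametric integrals and joint continuity -/

theorem continuousOn_intervalIntegral_of_continuousOn_prod {S : Set ℝ} {g : ℝ → ℝ → ℝ} {a b : ℝ}
    (hg : ContinuousOn (fun p : ℝ × ℝ => g p.1 p.2) (S ×ˢ univ)) :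
    ContinuousOn (fun s => ∫ x in a..b, g s x) S := by
  rw [continuousOn_iff_continuous_domRestrict]
  refine intervalIntegral.continuous_parametric_intervalIntegral_of_continuous'
    (f := fun (s : S) x => g s x) ?_ a b
  exact hg.comp_continuous (f := fun q : S × ℝ => ((q.1 : ℝ), q.2)) (by fun_prop)
    (fun q => ⟨q.1.2, mem_univ _⟩)

theorem hasDerivAt_intervalIntegral_of_continuousOn_prod {I : Set ℝ} (hI : IsOpen I)
    {g g' : ℝ → ℝ → ℝ} {a b s : ℝ} (hs : s ∈ I)
    (hcont : ∀ r ∈ I, Continuous (g r))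
    (hderiv : ∀ r ∈ I, ∀ x, HasDerivAt (fun r => g r x) (g' r x) r)
    (hg' : ContinuousOn (fun p : ℝ × ℝ => g' p.1 p.2) (I ×ˢ univ)) :
    HasDerivAt (fun r => ∫ x in a..b, g r x) (∫ x in a..b, g' s x) s := by
  obtain ⟨ε, hε, hball⟩ := Metric.nhds_basis_closedBall.mem_iff.1 (hI.mem_nhds hs)
  have hK : IsCompact (Metric.closedBall s ε ×ˢ uIcc a b) :=
    (isCompact_closedBall s ε).prod isCompact_uIcc
  obtain ⟨C, hC⟩ := hK.exists_bound_of_continuousOn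
    (hg'.mono (prod_mono hball (subset_univ _)))
  have hg's : Continuous (g' s) :=
    hg'.comp_continuous (f := fun x => (s, x)) (by fun_prop) (fun x => ⟨hs, mem_univ _⟩)
  refine (intervalIntegral.hasDerivAt_integral_of_dominated_loc_of_deriv_le
    (bound := fun _ => C) (Metric.closedBall_mem_nhds s hε) ?_
    ((hcont s hs).intervalIntegrable a b) hg's.aestronglyMeasurable ?_
    intervalIntegrable_const ?_).2
  · filter_upwards [hI.mem_nhds hs] with r hr using (hcont r hr).aestronglyMeasurable
  · exact ae_of_all _ fun x hx r hr => hC (r, x) ⟨hr, uIoc_subset_uIcc hx⟩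
  · exact ae_of_all _ fun x _ r hr => hderiv r (hball hr) x

namespace IsC12On

variable {I : Set ℝ} {u : ℝ → ℝ → ℝ}

/-- Near a point, `u_t` is bounded on a compact box, so `u` is Lipschitz in time uniformly in `x`;
together with continuity in `x` at one fixed time this gives joint continuity. -/
theorem continuousOn (hu : IsC12On I u) (hI : IsOpen I) :
    ContinuousOn (fun p : ℝ × ℝ => u p.1 p.2) (I ×ˢ univ) := by
  rintro ⟨s, x⟩ ⟨hs, -⟩
  refine ContinuousAt.continuousWithinAt ?_
  have hs' : s ∈ I := hs
  obtain ⟨ε, hε, hball⟩ := Metric.nhds_basis_closedBall.mem_iff.1 (hI.mem_nhds hs')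
  have hK : IsCompact (Metric.closedBall s ε ×ˢ Metric.closedBall x 1) :=
    (isCompact_closedBall s ε).prod (isCompact_closedBall x 1)
  obtain ⟨C, hC⟩ := hK.exists_bound_of_continuousOn
    (hu.continuousOn_time_deriv.mono (prod_mono hball (subset_univ _)))
  have hbound : ∀ᶠ p in 𝓝 (s, x), ‖u p.1 p.2 - u s p.2‖ ≤ C * ‖p.1 - s‖ := by
    filter_upwards [prod_mem_nhds (Metric.closedBall_mem_nhds s hε)
      (Metric.closedBall_mem_nhds x one_pos)] with p hp
    exact (convex_closedBall s ε).norm_image_sub_le_of_norm_deriv_le (f := fun r => u r p.2)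
      (fun r hr => hu.differentiable_time r (hball hr) p.2) (fun r hr => hC (r, p.2) ⟨hr, hp.2⟩)
      (Metric.mem_closedBall_self hε.le) hp.1
  have h1 : Tendsto (fun p : ℝ × ℝ => u p.1 p.2 - u s p.2) (𝓝 (s, x)) (𝓝 0) := by
    refine squeeze_zero_norm' hbound ?_
    have : Continuous fun p : ℝ × ℝ => C * ‖p.1 - s‖ := by fun_prop
    simpa using this.tendsto (s, x)
  have h2 : Tendsto (fun p : ℝ × ℝ => u s p.2) (𝓝 (s, x)) (𝓝 (u s x)) :=
    (((hu.differentiable_space s hs').continuous).comp continuous_snd).tendsto (s, x)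
  simpa [ContinuousAt] using h1.add h2

theorem continuous_space (hu : IsC12On I u) {s : ℝ} (hs : s ∈ I) : Continuous (u s) :=
  (hu.differentiable_space s hs).continuous

theorem continuous_space_deriv_deriv (hu : IsC12On I u) {s : ℝ} (hs : s ∈ I) :
    Continuous (deriv (deriv (u s))) :=
  hu.continuousOn_space_deriv_deriv.comp_continuous (f := fun x => (s, x)) (by fun_prop)
    (fun _ => ⟨hs, mem_univ _⟩)

end IsC12On

/-! ### The cutoff and its estimates -/

/-- The cutoff `(1 - e x²)²`, to be used on the interval `[-R, R]` with `e = 1 / R²`. -/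
def bump (e x : ℝ) : ℝ := (1 - e * x ^ 2) ^ 2

/-- The derivative of `bump e`. -/
def bumpDeriv (e x : ℝ) : ℝ := -4 * e * x * (1 - e * x ^ 2)

/-- The second derivative of `bump e`. -/
def bumpDeriv2 (e x : ℝ) : ℝ := e * (12 * e * x ^ 2 - 4)

theorem hasDerivAt_bump (e x : ℝ) : HasDerivAt (bump e) (bumpDeriv e x) x := by
  have h := (((hasDerivAt_pow 2 x).const_mul e).const_sub 1).fun_pow 2
  refine h.congr_deriv ?_
  simp [bumpDeriv]; ring

theorem hasDerivAt_bumpDeriv (e x : ℝ) : HasDerivAt (bumpDeriv e) (bumpDeriv2 e x) x := by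
  have h := ((hasDerivAt_id x).const_mul (-4 * e)).fun_mul
    (((hasDerivAt_pow 2 x).const_mul e).const_sub 1)
  refine h.congr_deriv ?_
  simp [bumpDeriv2]; ring

theorem continuous_bump (e : ℝ) : Continuous (bump e) := by unfold bump; fun_prop

theorem continuous_bumpDeriv (e : ℝ) : Continuous (bumpDeriv e) := by unfold bumpDeriv; fun_prop

theorem continuous_bumpDeriv2 (e : ℝ) : Continuous (bumpDeriv2 e) := by unfold bumpDeriv2; fun_prop

theorem bump_nonneg (e x : ℝ) : 0 ≤ bump e x := sq_nonneg _

section Estimates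

variable {e x : ℝ}

theorem bump_le_one (he : 0 ≤ e) (hx : e * x ^ 2 ≤ 1) : bump e x ≤ 1 := by
  have : 0 ≤ e * x ^ 2 := by positivity
  unfold bump; nlinarith

/-- The double zero of the cutoff at the endpoints makes the squared derivative comparable to the
cutoff itself, as needed to absorb cross terms by completing a square. -/
theorem bumpDeriv_sq_le (he : 0 ≤ e) (hx : e * x ^ 2 ≤ 1) :
    bumpDeriv e x ^ 2 ≤ 16 * e * bump e x := by
  have h : bumpDeriv e x ^ 2 = 16 * e * bump e x * (e * x ^ 2) := by
    unfold bumpDeriv bump; ring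
  rw [h]
  exact mul_le_of_le_one_right (mul_nonneg (by positivity) (bump_nonneg e x)) hx

theorem bumpDeriv2_le (he : 0 ≤ e) (hx : e * x ^ 2 ≤ 1) : bumpDeriv2 e x ≤ 8 * e := by
  unfold bumpDeriv2; nlinarith

/-- The lower bound is a multiple of the cutoff, so that the localised mass obeys a closed
differential inequality. It is possible because the second derivative is positive where the cutoff
vanishes. -/
theorem neg_bump_le_bumpDeriv2 (he : 0 ≤ e) : -(5 * e) * bump e x ≤ bumpDeriv2 e x := by
  have h : bumpDeriv2 e x + 5 * e * bump e x = e * (5 * (e * x ^ 2) ^ 2 + 2 * (e * x ^ 2) + 1) := by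
    unfold bumpDeriv2 bump; ring
  have : 0 ≤ e * (5 * (e * x ^ 2) ^ 2 + 2 * (e * x ^ 2) + 1) := by positivity
  linarith

end Estimates

theorem inv_sq_mul_sq_le_one {R x : ℝ} (hR : 0 < R) (hx : x ∈ Icc (-R) R) :
    (R ^ 2)⁻¹ * x ^ 2 ≤ 1 := by
  rw [inv_mul_le_iff₀ (by positivity), mul_one]
  exact sq_le_sq' hx.1 hx.2

theorem bump_boundary {R x : ℝ} (hR : 0 < R) (hx : x ^ 2 = R ^ 2) : bump (R ^ 2)⁻¹ x = 0 := by
  unfold bump; rw [hx, inv_mul_cancel₀ (by positivity)]; simp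

theorem bumpDeriv_boundary {R x : ℝ} (hR : 0 < R) (hx : x ^ 2 = R ^ 2) :
    bumpDeriv (R ^ 2)⁻¹ x = 0 := by
  unfold bumpDeriv; rw [hx, inv_mul_cancel₀ (by positivity)]; simp

theorem tendsto_intervalIntegral_mul_bump {g : ℝ → ℝ} (hg : Integrable g) :
    Tendsto (fun R : ℝ => ∫ x in -R..R, g x * bump (R ^ 2)⁻¹ x) atTop (𝓝 (∫ x, g x)) := by
  have h : Tendsto (fun R : ℝ => ∫ x, (Ioc (-R) R).indicator (fun x => g x * bump (R ^ 2)⁻¹ x) x)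
      atTop (𝓝 (∫ x, g x)) := by
    refine tendsto_integral_filter_of_dominated_convergence (fun x => ‖g x‖) ?_ ?_ hg.norm ?_
    · exact Eventually.of_forall fun R =>
        (hg.aestronglyMeasurable.mul (continuous_bump _).aestronglyMeasurable).indicator
          measurableSet_Ioc
    · filter_upwards [eventually_gt_atTop 0] with R hR
      refine ae_of_all _ fun x => ?_
      by_cases hx : x ∈ Ioc (-R) R
      · rw [indicator_of_mem hx, norm_mul, Real.norm_of_nonneg (bump_nonneg _ x)]
        exact mul_le_of_le_one_right (norm_nonneg _) (bump_le_one (by positivity)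
          (inv_sq_mul_sq_le_one hR (Ioc_subset_Icc_self hx)))
      · rw [indicator_of_notMem hx]; simp
    · refine ae_of_all _ fun x => ?_
      have h1 : Tendsto (fun R : ℝ => (R ^ 2)⁻¹) atTop (𝓝 0) :=
        tendsto_inv_atTop_zero.comp (tendsto_pow_atTop two_ne_zero)
      have h2 : Tendsto (fun R : ℝ => g x * bump (R ^ 2)⁻¹ x) atTop (𝓝 (g x)) := by
        have : Continuous fun e : ℝ => g x * bump e x := by unfold bump; fun_prop
        have h3 := (this.tendsto 0).comp h1
        simpa [bump, Function.comp_def] using h3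
      refine h2.congr' ?_
      filter_upwards [eventually_gt_atTop |x|] with R hR
      rw [indicator_of_mem]
      exact ⟨by linarith [neg_abs_le x], by linarith [le_abs_self x]⟩
  refine h.congr' ?_
  filter_upwards [eventually_gt_atTop 0] with R hR
  rw [integral_indicator measurableSet_Ioc, intervalIntegral.integral_of_le (by linarith)]

/-- The cutoff and its derivative both vanish at `±R`, so integrating by parts twice leaves no
boundary terms and no derivative of `p`. -/
theorem integral_deriv_deriv_mul_bump {p : ℝ → ℝ} (hp : Differentiable ℝ p)
    (hp' : Differentiable ℝ (deriv p)) (hp'' : Continuous (deriv (deriv p))) {R : ℝ} (hR : 0 < R) :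
    ∫ x in -R..R, deriv (deriv p) x * bump (R ^ 2)⁻¹ x =
      ∫ x in -R..R, p x * bumpDeriv2 (R ^ 2)⁻¹ x := by
  have hd : ∀ x ∈ uIcc (-R) R, HasDerivAt
      (fun x => deriv p x * bump (R ^ 2)⁻¹ x - p x * bumpDeriv (R ^ 2)⁻¹ x)
      (deriv (deriv p) x * bump (R ^ 2)⁻¹ x - p x * bumpDeriv2 (R ^ 2)⁻¹ x) x := by
    intro x _
    refine (((hp' x).hasDerivAt.fun_mul (hasDerivAt_bump _ x)).fun_sub
      ((hp x).hasDerivAt.fun_mul (hasDerivAt_bumpDeriv _ x))).congr_deriv ?_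
    ring
  have hc1 : Continuous fun x => deriv (deriv p) x * bump (R ^ 2)⁻¹ x :=
    hp''.mul (continuous_bump _)
  have hc2 : Continuous fun x => p x * bumpDeriv2 (R ^ 2)⁻¹ x :=
    hp.continuous.mul (continuous_bumpDeriv2 _)
  have h := intervalIntegral.integral_eq_sub_of_hasDerivAt hd
    ((hc1.sub hc2).intervalIntegrable _ _)
  rw [intervalIntegral.integral_sub (hc1.intervalIntegrable _ _) (hc2.intervalIntegrable _ _),
    bump_boundary hR rfl, bump_boundary hR (neg_sq R), bumpDeriv_boundary hR rfl,
    bumpDeriv_boundary hR (neg_sq R)] at h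
  linarith

/-! ### Mass of the linear solution -/

namespace IsLinearSolution

variable {f : ℝ → ℝ} {w : ℝ → ℝ → ℝ}

theorem hasDerivAt_integral_mul_bump (hf : Continuous f) (hw : IsLinearSolution f w) {R s : ℝ}
    (hR : 0 < R) (hs : 0 < s) :
    HasDerivAt (fun r => ∫ x in -R..R, w r x * bump (R ^ 2)⁻¹ x)
      (∫ x in -R..R, w s x * (bumpDeriv2 (R ^ 2)⁻¹ x - 2 * f x * bump (R ^ 2)⁻¹ x)) s := by
  have h := hasDerivAt_intervalIntegral_of_continuousOn_prod isOpen_Ioi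
    (g := fun r x => w r x * bump (R ^ 2)⁻¹ x)
    (g' := fun r x => deriv (fun r => w r x) r * bump (R ^ 2)⁻¹ x) (a := -R) (b := R) (s := s)
    (I := Ioi 0) hs
    (fun r hr => (hw.isC12On.continuous_space hr).mul (continuous_bump _))
    (fun r hr x => (hw.isC12On.differentiable_time r hr x).hasDerivAt.mul_const _)
    (hw.isC12On.continuousOn_time_deriv.mul
      ((continuous_bump _).comp continuous_snd).continuousOn)
  refine h.congr_deriv ?_
  have hc := hw.isC12On.continuous_space hs
  have hc2 := hw.isC12On.continuous_space_deriv_deriv hs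
  have hb := continuous_bump (R ^ 2)⁻¹
  have hb2 := continuous_bumpDeriv2 (R ^ 2)⁻¹
  have i1 : IntervalIntegrable (fun x => deriv (deriv (w s)) x * bump (R ^ 2)⁻¹ x) volume (-R) R :=
    (hc2.mul hb).intervalIntegrable _ _
  have i2 : IntervalIntegrable (fun x => w s x * bumpDeriv2 (R ^ 2)⁻¹ x) volume (-R) R :=
    (hc.mul hb2).intervalIntegrable _ _
  have i3 : IntervalIntegrable (fun x => w s x * (2 * f x * bump (R ^ 2)⁻¹ x)) volume (-R) R :=
    (by fun_prop : Continuous _).intervalIntegrable _ _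
  calc ∫ x in -R..R, deriv (fun r => w r x) s * bump (R ^ 2)⁻¹ x
      = ∫ x in -R..R, (deriv (deriv (w s)) x * bump (R ^ 2)⁻¹ x
          - w s x * (2 * f x * bump (R ^ 2)⁻¹ x)) := by
        refine intervalIntegral.integral_congr fun x _ => ?_
        simp only [hw.equation s hs x]; ring
    _ = _ := by
        simp only [mul_sub]
        rw [intervalIntegral.integral_sub i1 i3, intervalIntegral.integral_sub i2 i3,
          integral_deriv_deriv_mul_bump (hw.isC12On.differentiable_space s hs)
            (hw.isC12On.differentiable_space_deriv s hs) hc2 hR]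

/-- Gronwall backward in time: `f ≤ F` and `neg_bump_le_bumpDeriv2` bound the decay rate of the
localised mass by `L = 2F + 5/R²`, so earlier masses are controlled by later ones. -/
theorem integral_mul_bump_le_exp_mul (hf : Continuous f) {F : ℝ} (hF : ∀ x, f x ≤ F)
    (hw : IsLinearSolution f w) (hw0 : ∀ s, 0 < s → ∀ x, 0 ≤ w s x) {R s t : ℝ}
    (hR : 0 < R) (hs : 0 < s) (hst : s ≤ t) :
    ∫ x in -R..R, w s x * bump (R ^ 2)⁻¹ x ≤
      Real.exp ((2 * F + 5 * (R ^ 2)⁻¹) * (t - s)) * ∫ x in -R..R, w t x * bump (R ^ 2)⁻¹ x := by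
  set e := (R ^ 2)⁻¹ with he
  have he0 : 0 ≤ e := by positivity
  set M := fun r => ∫ x in -R..R, w r x * bump e x with hM
  set D := fun r => ∫ x in -R..R, w r x * (bumpDeriv2 e x - 2 * f x * bump e x) with hD
  set L := 2 * F + 5 * e
  have hMD : ∀ r, 0 < r → HasDerivAt M (D r) r := fun r hr =>
    hasDerivAt_integral_mul_bump hf hw hR hr
  have hlow : ∀ r, 0 < r → -L * M r ≤ D r := by
    intro r hr
    have hc := hw.isC12On.continuous_space (s := r) hr
    have hb := continuous_bump e
    have hb2 := continuous_bumpDeriv2 e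
    simp only [hM, hD]
    rw [← intervalIntegral.integral_const_mul]
    refine intervalIntegral.integral_mono_on (by linarith)
      ((by fun_prop : Continuous _).intervalIntegrable _ _)
      ((by fun_prop : Continuous _).intervalIntegrable _ _) fun x _ => ?_
    have h1 := neg_bump_le_bumpDeriv2 (x := x) he0
    have h2 := mul_le_mul_of_nonneg_right (hF x) (bump_nonneg e x)
    have h3 : -L * bump e x ≤ bumpDeriv2 e x - 2 * f x * bump e x := by
      simp only [L]; linarith
    have h4 := mul_le_mul_of_nonneg_left h3 (hw0 r hr x)
    linarith
  have hE : ∀ r, 0 < r → HasDerivAt (fun r => Real.exp (L * r) * M r)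
      (Real.exp (L * r) * (L * M r + D r)) r := by
    intro r hr
    refine ((((hasDerivAt_id r).const_mul L).exp).fun_mul (hMD r hr)).congr_deriv ?_
    simp only [id]; ring
  have hmono : MonotoneOn (fun r => Real.exp (L * r) * M r) (Ioi 0) := by
    refine monotoneOn_of_deriv_nonneg (convex_Ioi 0)
      (fun r hr => (hE r hr).continuousAt.continuousWithinAt)
      (fun r hr => (hE r (interior_subset hr)).differentiableAt.differentiableWithinAt)
      fun r hr => ?_
    have hr' : 0 < r := interior_subset hr
    rw [(hE r hr').deriv]
    have := hlow r hr'
    exact mul_nonneg (Real.exp_pos _).le (by linarith)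
  have h := hmono hs (hs.trans_le hst : 0 < t) hst
  have hsplit : Real.exp (L * t) = Real.exp (L * s) * Real.exp (L * (t - s)) := by
    rw [← Real.exp_add]; ring_nf
  simp only [hsplit, mul_assoc] at h
  exact le_of_mul_le_mul_left h (Real.exp_pos _)

theorem intervalIntegral_mul_bump_le (hw : IsLinearSolution f w)
    (hw0 : ∀ s, 0 < s → ∀ x, 0 ≤ w s x) {R s : ℝ} (hR : 0 < R) (hs : 0 < s)
    (hint : Integrable (w s)) :
    ∫ x in -R..R, w s x * bump (R ^ 2)⁻¹ x ≤ ∫ x, w s x := by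
  have hc := hw.isC12On.continuous_space (s := s) hs
  calc ∫ x in -R..R, w s x * bump (R ^ 2)⁻¹ x ≤ ∫ x in -R..R, w s x := by
        refine intervalIntegral.integral_mono_on (by linarith)
          ((hc.mul (continuous_bump _)).intervalIntegrable _ _) (hc.intervalIntegrable _ _)
          fun x hx => mul_le_of_le_one_right (hw0 s hs x)
            (bump_le_one (by positivity) (inv_sq_mul_sq_le_one hR hx))
    _ ≤ ∫ x, w s x := by
        rw [intervalIntegral.integral_of_le (by linarith)]
        exact setIntegral_le_integral hint (ae_of_all _ (hw0 s hs))

/-- The backward Gronwall constant stays bounded as `R → ∞`, so integrability at time `t` passes to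
all earlier times, with a bound uniform in `s`. -/
theorem exists_integral_le (hf : Continuous f) (hf0 : ∀ x, 0 ≤ f x) {F : ℝ} (hF : ∀ x, f x ≤ F)
    (hw : IsLinearSolution f w) (hw0 : ∀ s, 0 < s → ∀ x, 0 ≤ w s x) {t : ℝ} (ht : 0 < t)
    (hint : Integrable (w t)) :
    ∀ s ∈ Ioc 0 t, Integrable (w s) ∧
      ∫ x, w s x ≤ 2 * (Real.exp ((2 * F + 5) * t) * ∫ x, w t x) := by
  intro s hs
  have hc := hw.isC12On.continuous_space (s := s) hs.1
  have hF0 : 0 ≤ F := (hf0 0).trans (hF 0)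
  have hbound : ∀ R : ℝ, 1 ≤ R → ∫ x in -(R / 2)..(R / 2), w s x ≤
      2 * (Real.exp ((2 * F + 5) * t) * ∫ x, w t x) := by
    intro R hR
    have hR0 : 0 < R := by linarith
    have h1 := integral_mul_bump_le_exp_mul hf hF hw hw0 hR0 hs.1 hs.2
    have h2 := intervalIntegral_mul_bump_le hw hw0 hR0 ht hint
    have he1 : (R ^ 2)⁻¹ ≤ 1 := inv_le_one_of_one_le₀ (one_le_pow₀ hR)
    have h3 : Real.exp ((2 * F + 5 * (R ^ 2)⁻¹) * (t - s)) ≤ Real.exp ((2 * F + 5) * t) := by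
      refine Real.exp_le_exp.2 (mul_le_mul (by linarith) (by linarith [hs.1])
        (by linarith [hs.2]) (by linarith))
    have h4 : ∫ x in -R..R, w s x * bump (R ^ 2)⁻¹ x ≤
        Real.exp ((2 * F + 5) * t) * ∫ x, w t x :=
      h1.trans (mul_le_mul h3 h2 (intervalIntegral.integral_nonneg (by linarith)
        fun x _ => mul_nonneg (hw0 t ht x) (bump_nonneg _ x)) (Real.exp_pos _).le)
    -- The factor 2 arises because the cutoff is at least `(3/4)² = 9/16` on the half interval.
    have h5 : ∫ x in -(R / 2)..(R / 2), w s x ≤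
        ∫ x in -(R / 2)..(R / 2), 2 * (w s x * bump (R ^ 2)⁻¹ x) := by
      have hb := continuous_bump (R ^ 2)⁻¹
      refine intervalIntegral.integral_mono_on (by linarith) (hc.intervalIntegrable _ _)
        ((by fun_prop : Continuous _).intervalIntegrable _ _) fun x hx => ?_
      have hx2 : (R ^ 2)⁻¹ * x ^ 2 ≤ 1 / 4 := by
        rw [inv_mul_le_iff₀ (by positivity)]
        have := sq_le_sq' hx.1 hx.2
        linarith
      have : 1 / 2 ≤ bump (R ^ 2)⁻¹ x := by unfold bump; nlinarith
      have := mul_le_mul_of_nonneg_left this (hw0 s hs.1 x)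
      linarith
    have h6 : ∫ x in -(R / 2)..(R / 2), w s x * bump (R ^ 2)⁻¹ x ≤
        ∫ x in -R..R, w s x * bump (R ^ 2)⁻¹ x :=
      intervalIntegral.integral_mono_interval (by linarith) (by linarith) (by linarith)
        (ae_of_all _ fun x => mul_nonneg (hw0 s hs.1 x) (bump_nonneg _ x))
        ((hc.mul (continuous_bump _)).intervalIntegrable _ _)
    rw [intervalIntegral.integral_const_mul] at h5
    linarith
  have htop : Tendsto (fun R : ℝ => R / 2) atTop atTop :=
    tendsto_id.atTop_div_const two_pos
  have hbot : Tendsto (fun R : ℝ => -(R / 2)) atTop atBot := tendsto_neg_atTop_atBot.comp htop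
  have hi : Integrable (w s) := by
    refine integrable_of_intervalIntegral_norm_bounded (l := atTop) (a := fun R : ℝ => -(R / 2))
      (b := fun R : ℝ => R / 2) (2 * (Real.exp ((2 * F + 5) * t) * ∫ x, w t x)) (fun R => (hc.integrableOn_Icc).mono_set Ioc_subset_Icc_self)
      hbot htop ?_
    filter_upwards [eventually_ge_atTop 1] with R hR
    simpa only [Real.norm_of_nonneg (hw0 s hs.1 _)] using hbound R hR
  refine ⟨hi, ?_⟩
  refine le_of_tendsto (intervalIntegral_tendsto_integral hi hbot htop) ?_
  filter_upwards [eventually_ge_atTop 1] with R hR using hbound R hR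

/-- Since `f ≥ 0`, the localised mass can grow only through the second derivative of the cutoff, at
rate at most `8K/R²`, which vanishes as `R → ∞`. -/
theorem integral_antitone (hf : Continuous f) (hf0 : ∀ x, 0 ≤ f x) {F : ℝ} (hF : ∀ x, f x ≤ F)
    (hw : IsLinearSolution f w) (hw0 : ∀ s, 0 < s → ∀ x, 0 ≤ w s x) {t : ℝ} (ht : 0 < t)
    (hint : Integrable (w t)) :
    AntitoneOn (fun s => ∫ x, w s x) (Ioc 0 t) := by
  intro a ha b hb hab
  have hB := exists_integral_le hf hf0 hF hw hw0 ht hint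
  set K := 2 * (Real.exp ((2 * F + 5) * t) * ∫ x, w t x)
  have hR : ∀ R : ℝ, 0 < R → ∫ x in -R..R, w b x * bump (R ^ 2)⁻¹ x ≤
      (∫ x in -R..R, w a x * bump (R ^ 2)⁻¹ x) + 8 * (R ^ 2)⁻¹ * K * (b - a) := by
    intro R hR
    set e := (R ^ 2)⁻¹ with he
    have he0 : 0 ≤ e := by positivity
    have hd : ∀ r ∈ Icc a b, HasDerivAt (fun r => ∫ x in -R..R, w r x * bump e x)
        (∫ x in -R..R, w r x * (bumpDeriv2 e x - 2 * f x * bump e x)) r := fun r hr =>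
      hasDerivAt_integral_mul_bump hf hw hR (ha.1.trans_le hr.1)
    have h := (convex_Icc a b).image_sub_le_mul_sub_of_deriv_le
      (f := fun r => ∫ x in -R..R, w r x * bump e x) (C := 8 * e * K)
      (fun r hr => (hd r hr).continuousAt.continuousWithinAt)
      (fun r hr => (hd r (interior_subset hr)).differentiableAt.differentiableWithinAt) ?_
      a (left_mem_Icc.2 hab) b (right_mem_Icc.2 hab) hab
    · linarith
    · intro r hr
      have hr' := interior_subset hr
      have hr0 : 0 < r := ha.1.trans_le hr'.1
      rw [(hd r hr').deriv]
      have hc := hw.isC12On.continuous_space (s := r) hr0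
      have hb' := continuous_bump e
      have hb2 := continuous_bumpDeriv2 e
      have hrB := hB r ⟨hr0, hr'.2.trans hb.2⟩
      calc ∫ x in -R..R, w r x * (bumpDeriv2 e x - 2 * f x * bump e x)
          ≤ ∫ x in -R..R, 8 * e * w r x := by
            refine intervalIntegral.integral_mono_on (by linarith)
              ((by fun_prop : Continuous _).intervalIntegrable _ _)
              ((by fun_prop : Continuous _).intervalIntegrable _ _) fun x hx => ?_
            have h1 := bumpDeriv2_le he0 (inv_sq_mul_sq_le_one hR hx)
            have h2 := mul_nonneg (hf0 x) (bump_nonneg e x)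
            have h3 := mul_le_mul_of_nonneg_left
              (by linarith : bumpDeriv2 e x - 2 * f x * bump e x ≤ 8 * e) (hw0 r hr0 x)
            linarith
        _ ≤ 8 * e * K := by
            rw [intervalIntegral.integral_const_mul]
            refine mul_le_mul_of_nonneg_left ?_ (by positivity)
            rw [intervalIntegral.integral_of_le (by linarith)]
            exact (setIntegral_le_integral hrB.1 (ae_of_all _ (hw0 r hr0))).trans hrB.2
  have hlim : Tendsto (fun R : ℝ => (∫ x in -R..R, w a x * bump (R ^ 2)⁻¹ x)
      + 8 * (R ^ 2)⁻¹ * K * (b - a)) atTop (𝓝 (∫ x, w a x)) := by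
    have h1 : Tendsto (fun R : ℝ => (R ^ 2)⁻¹) atTop (𝓝 0) :=
      tendsto_inv_atTop_zero.comp (tendsto_pow_atTop two_ne_zero)
    simpa using (tendsto_intervalIntegral_mul_bump (hB a ha).1).add
      (((h1.const_mul 8).mul_const K).mul_const (b - a))
  refine le_of_tendsto_of_tendsto (tendsto_intervalIntegral_mul_bump (hB b hb).1) hlim ?_
  filter_upwards [eventually_gt_atTop 0] with R h0 using hR R h0

end IsLinearSolution

/-! ### Saturation and the localised energy inequality -/

/-- The saturation `q / (1 + d q)`, which is concave, bounded by `1 / d`, and satisfies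
`G'(q) q² = G(q)²`. -/
noncomputable def sat (d q : ℝ) : ℝ := q / (1 + d * q)

/-- The derivative of `sat d`. -/
noncomputable def satDeriv (d q : ℝ) : ℝ := 1 / (1 + d * q) ^ 2

/-- The second derivative of `sat d`. -/
noncomputable def satDeriv2 (d q : ℝ) : ℝ := -(2 * d) / (1 + d * q) ^ 3

theorem hasDerivAt_sat {d q : ℝ} (h : 1 + d * q ≠ 0) : HasDerivAt (sat d) (satDeriv d q) q := by
  refine ((hasDerivAt_id q).fun_div (((hasDerivAt_id q).const_mul d).const_add 1) h).congr_deriv ?_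
  simp only [satDeriv, id]; congr 1; ring

theorem hasDerivAt_satDeriv {d q : ℝ} (h : 1 + d * q ≠ 0) :
    HasDerivAt (satDeriv d) (satDeriv2 d q) q := by
  refine ((hasDerivAt_const q (1 : ℝ)).fun_div
    ((((hasDerivAt_id q).const_mul d).const_add 1).fun_pow 2) (pow_ne_zero 2 h)).congr_deriv ?_
  simp only [satDeriv2, id]
  field_simp
  push_cast
  ring

theorem sat_nonneg {d q : ℝ} (hd : 0 < d) (hq : 0 ≤ q) : 0 ≤ sat d q := by unfold sat; positivity

theorem sat_le_inv {d q : ℝ} (hd : 0 < d) (hq : 0 ≤ q) : sat d q ≤ d⁻¹ := by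
  unfold sat
  rw [div_le_iff₀ (by positivity), mul_add, inv_mul_cancel_left₀ hd.ne']
  have : 0 < d⁻¹ * 1 := by positivity
  linarith

theorem continuousOn_sat {d : ℝ} (hd : 0 < d) : ContinuousOn (sat d) (Ici 0) := fun q hq =>
  (hasDerivAt_sat (by have : 0 ≤ q := hq; positivity)).continuousAt.continuousWithinAt

theorem continuousOn_satDeriv {d : ℝ} (hd : 0 < d) : ContinuousOn (satDeriv d) (Ici 0) :=
  fun q hq =>
  (hasDerivAt_satDeriv (by have : 0 ≤ q := hq; positivity)).continuousAt.continuousWithinAt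

theorem continuousOn_satDeriv2 {d : ℝ} (hd : 0 < d) : ContinuousOn (satDeriv2 d) (Ici 0) := by
  unfold satDeriv2
  refine ContinuousOn.div (by fun_prop) (by fun_prop) fun q hq => ?_
  have : 0 ≤ q := hq
  positivity

/-- Here `a` stands for `q_x`, `c, c1, c2` for the cutoff and its derivatives, and `g` for the
potential. Half of the error `16e/d` pays for `c2 G`, through `G ≤ 1/d`, and half for the cross
term. -/
theorem sat_energy_pointwise {d e q a c c1 c2 g : ℝ} (hd : 0 < d) (he : 0 ≤ e) (hq : 0 ≤ q)
    (hc : 0 ≤ c) (hc1 : c1 ^ 2 ≤ 16 * e * c) (hc2 : c2 ≤ 8 * e) (hg : 0 ≤ g) :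
    c * sat d q ^ 2 - 16 * e / d ≤ 2 * g * c * (sat d q - q * satDeriv d q)
      + c * satDeriv d q * q ^ 2 - c * satDeriv2 d q * a ^ 2 - 2 * c1 * satDeriv d q * a
      - c2 * sat d q := by
  have hk : 0 < 1 + d * q := by positivity
  have h1 : 0 ≤ sat d q - q * satDeriv d q := by
    have : sat d q - q * satDeriv d q = d * q ^ 2 / (1 + d * q) ^ 2 := by
      unfold sat satDeriv; field_simp; ring
    rw [this]; positivity
  have h2 : satDeriv d q * q ^ 2 = sat d q ^ 2 := by unfold sat satDeriv; field_simp
  have h3 : c2 * sat d q ≤ 8 * e / d := by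
    rw [div_eq_mul_inv]
    exact (mul_le_mul_of_nonneg_right hc2 (sat_nonneg hd hq)).trans
      (mul_le_mul_of_nonneg_left (sat_le_inv hd hq) (by positivity))
  set X := satDeriv d q * a with hX
  have h4 : -(c * satDeriv2 d q * a ^ 2) = 2 * d * c * X ^ 2 * (1 + d * q) := by
    rw [hX]; unfold satDeriv satDeriv2; field_simp
  -- AM-GM: the outer coefficients have product `2dc · 8e/d = 16ec`, exactly the bound on `c1²`.
  have h5 : 0 ≤ 2 * d * c * X ^ 2 - 2 * c1 * X + 8 * e / d := by
    have h6 : c1 ^ 2 * X ^ 2 ≤ 16 * e * c * X ^ 2 :=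
      mul_le_mul_of_nonneg_right hc1 (sq_nonneg X)
    have h7 : 2 * c1 * X ≤ 2 * d * c * X ^ 2 + 8 * e / d := by
      refine abs_le_of_sq_le_sq' ?_ (by positivity) |>.2
      have h8 : (2 * d * c * X ^ 2 + 8 * e / d) ^ 2 =
          (2 * d * c * X ^ 2 - 8 * e / d) ^ 2 + 4 * (16 * e * c * X ^ 2) := by
        field_simp; ring
      nlinarith [sq_nonneg (2 * d * c * X ^ 2 - 8 * e / d)]
    linarith
  have h9 : 0 ≤ 2 * d * c * X ^ 2 * (d * q) := by positivity
  have h10 : 0 ≤ 2 * g * c * (sat d q - q * satDeriv d q) := by positivity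
  have h11 : 16 * e / d = 8 * e / d + 8 * e / d := by ring
  have h12 : c * satDeriv d q * q ^ 2 = c * sat d q ^ 2 := by rw [← h2]; ring
  have h13 : 2 * c1 * satDeriv d q * a = 2 * c1 * X := by rw [hX]; ring
  linarith

theorem le_integral_sat_energy {p q f : ℝ → ℝ} (hf : Continuous f) (hf0 : ∀ x, 0 ≤ f x)
    (hp : Differentiable ℝ p) (hp' : Differentiable ℝ (deriv p))
    (hp'' : Continuous (deriv (deriv p))) (hp0 : ∀ x, 0 ≤ p x)
    (hq : Differentiable ℝ q) (hq' : Differentiable ℝ (deriv q))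
    (hq'' : Continuous (deriv (deriv q))) (hq0 : ∀ x, 0 ≤ q x)
    {d R : ℝ} (hd : 0 < d) (hR : 0 < R) :
    (∫ x in -R..R, p x * (bump (R ^ 2)⁻¹ x * sat d (q x) ^ 2 - 16 * (R ^ 2)⁻¹ / d)) ≤
      ∫ x in -R..R, (-(deriv (deriv p) x - 2 * f x * p x) * sat d (q x) +
        p x * (satDeriv d (q x) * (deriv (deriv q) x - 2 * f x * q x + q x ^ 2))) *
          bump (R ^ 2)⁻¹ x := by
  set e := (R ^ 2)⁻¹ with he
  have he0 : 0 ≤ e := by positivity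
  have hG : Continuous fun x => sat d (q x) :=
    (continuousOn_sat hd).comp_continuous hq.continuous hq0
  have hG1 : Continuous fun x => satDeriv d (q x) :=
    (continuousOn_satDeriv hd).comp_continuous hq.continuous hq0
  have hG2 : Continuous fun x => satDeriv2 d (q x) :=
    (continuousOn_satDeriv2 hd).comp_continuous hq.continuous hq0
  have hpc := hp.continuous
  have hpc' := hp'.continuous
  have hqc := hq.continuous
  have hqc' := hq'.continuous
  have hb := continuous_bump e
  have hb1 := continuous_bumpDeriv e
  have hb2 := continuous_bumpDeriv2 e
  -- This flux is chosen so that the terms in `p_x` cancel in its derivative. It vanishes at `±R`,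
  -- so adding `B'` leaves the integral unchanged and reduces the claim to the pointwise inequality
  -- times `p`.
  let B : ℝ → ℝ := fun x => bump e x * (p x * (satDeriv d (q x) * deriv q x)
    - deriv p x * sat d (q x)) + bumpDeriv e x * (p x * sat d (q x))
  let B' : ℝ → ℝ := fun x => bump e x * (p x * (satDeriv2 d (q x) * deriv q x * deriv q x
      + satDeriv d (q x) * deriv (deriv q) x) - deriv (deriv p) x * sat d (q x))
    + 2 * bumpDeriv e x * (p x * (satDeriv d (q x) * deriv q x))
    + bumpDeriv2 e x * (p x * sat d (q x))
  have hB'c : Continuous B' := by fun_prop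
  have hB : ∀ x, HasDerivAt B (B' x) x := by
    intro x
    have hk : 1 + d * q x ≠ 0 := by have := hq0 x; positivity
    have g0 : HasDerivAt (fun x => sat d (q x)) (satDeriv d (q x) * deriv q x) x :=
      (hasDerivAt_sat hk).comp x (hq x).hasDerivAt
    have g1 : HasDerivAt (fun x => satDeriv d (q x)) (satDeriv2 d (q x) * deriv q x) x :=
      (hasDerivAt_satDeriv hk).comp x (hq x).hasDerivAt
    refine (((hasDerivAt_bump e x).fun_mul (((hp x).hasDerivAt.fun_mul
      (g1.fun_mul (hq' x).hasDerivAt)).fun_sub ((hp' x).hasDerivAt.fun_mul g0))).fun_add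
      ((hasDerivAt_bumpDeriv e x).fun_mul ((hp x).hasDerivAt.fun_mul g0))).congr_deriv ?_
    simp only [B']; ring
  have hB0 : ∫ x in -R..R, B' x = 0 := by
    rw [intervalIntegral.integral_eq_sub_of_hasDerivAt (fun x _ => hB x)
      (hB'c.intervalIntegrable _ _)]
    simp only [B]
    rw [bump_boundary hR rfl, bump_boundary hR (neg_sq R), bumpDeriv_boundary hR rfl,
      bumpDeriv_boundary hR (neg_sq R)]
    simp
  have hlc : Continuous fun x => p x * (bump e x * sat d (q x) ^ 2 - 16 * e / d) := by fun_prop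
  rw [← add_zero (∫ x in -R..R, p x * _), ← hB0,
    ← intervalIntegral.integral_add (hlc.intervalIntegrable _ _) (hB'c.intervalIntegrable _ _)]
  refine intervalIntegral.integral_mono_on (by linarith)
    ((hlc.add hB'c).intervalIntegrable _ _)
    ((by fun_prop : Continuous _).intervalIntegrable _ _) fun x hx => ?_
  have hx1 := inv_sq_mul_sq_le_one hR hx
  have h := mul_le_mul_of_nonneg_left (sat_energy_pointwise (a := deriv q x) hd he0 (hq0 x)
    (bump_nonneg e x) (bumpDeriv_sq_le he0 hx1) (bumpDeriv2_le he0 hx1) (hf0 x)) (hp0 x)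
  simp only [B']
  linarith

/-! ### A Riccati inequality with error -/

/-- The error can lower `φ` by at most `η r`, so `φ ≥ c` throughout. Dividing the inequality by `φ²`
then gives `(-1/φ)' ≥ k - η/c²`, which is integrated over `[0, r]`. -/
theorem integral_le_inv_add_of_sq_le_deriv {φ D k : ℝ → ℝ} {r η c : ℝ} (hr : 0 ≤ r)
    (hη : 0 ≤ η) (hc : 0 < c) (hφ : ContinuousOn φ (Icc 0 r))
    (hD : ∀ s ∈ Ioo 0 r, HasDerivAt φ (D s) s) (hk0 : ∀ s ∈ Ioo 0 r, 0 ≤ k s)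
    (hk : IntegrableOn k (Icc 0 r)) (hkD : ∀ s ∈ Ioo 0 r, k s * φ s ^ 2 - η ≤ D s)
    (hcφ : c ≤ φ 0 - η * r) :
    ∫ s in (0 : ℝ)..r, k s ≤ (φ 0)⁻¹ + η * r / c ^ 2 := by
  have hlow : ∀ s ∈ Icc 0 r, c ≤ φ s := by
    intro s hs
    have h := (convex_Icc 0 r).mul_sub_le_image_sub_of_le_deriv (C := -η) hφ
      (fun x hx => by
        rw [interior_Icc] at hx
        exact (hD x hx).differentiableAt.differentiableWithinAt)
      (fun x hx => by
        rw [interior_Icc] at hx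
        rw [(hD x hx).deriv]
        have := mul_nonneg (hk0 x hx) (sq_nonneg (φ x))
        linarith [hkD x hx]) 0 (left_mem_Icc.2 hr) s hs hs.1
    have := mul_le_mul_of_nonneg_left hs.2 hη
    linarith
  have hpos : ∀ s ∈ Icc 0 r, 0 < φ s := fun s hs => hc.trans_le (hlow s hs)
  have hkint : IntervalIntegrable k volume 0 r :=
    (intervalIntegrable_iff_integrableOn_Icc_of_le hr).2 hk
  have h := intervalIntegral.integral_le_sub_of_hasDeriv_right_of_le (g := fun s => -(φ s)⁻¹)
    (g' := fun s => -(-D s / φ s ^ 2)) (φ := fun s => k s - η / c ^ 2) hr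
    (hφ.inv₀ fun s hs => (hpos s hs).ne').neg
    (fun s hs => ((hD s hs).fun_inv (hpos s (Ioo_subset_Icc_self hs)).ne').fun_neg.hasDerivWithinAt)
    (hk.sub (integrableOn_const (by simp)))
    (fun s hs => by
      have hs' := Ioo_subset_Icc_self hs
      have h1 := hpos s hs'
      have h2 : η / φ s ^ 2 ≤ η / c ^ 2 := by
        have := hlow s hs'
        gcongr
      have h3 : k s - η / φ s ^ 2 ≤ D s / φ s ^ 2 := by
        rw [le_div_iff₀ (by positivity), sub_mul, div_mul_cancel₀ _ (by positivity)]
        exact hkD s hs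
      rw [neg_div, neg_neg]
      linarith)
  rw [intervalIntegral.integral_sub hkint intervalIntegrable_const,
    intervalIntegral.integral_const] at h
  have := inv_pos.2 (hpos r (right_mem_Icc.2 hr))
  have h4 : (r - 0) • (η / c ^ 2) = η * r / c ^ 2 := by rw [smul_eq_mul]; ring
  rw [h4] at h
  linarith

/-! ### The regularised pairing of `-u` with the reversed linear solution -/

section Duality

variable {f h : ℝ → ℝ} {T : EReal} {u w : ℝ → ℝ → ℝ} {t : ℝ}

theorem isOpen_time_interval (T : EReal) : IsOpen {s : ℝ | 0 < s ∧ (s : EReal) < T} :=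
  (isOpen_lt continuous_const continuous_id).inter
    (isOpen_lt continuous_coe_real_ereal continuous_const)

/-- Both time derivatives are replaced using the equations, and the integrand is arranged to match
`le_integral_sat_energy` with `p = w (t - s)` and `q = -u s`. -/
theorem hasDerivAt_pairing (hu : IsClassicalSolution f h T u)
    (hu0 : ∀ s : ℝ, 0 ≤ s → (s : EReal) < T → ∀ x, u s x ≤ 0) (hw : IsLinearSolution f w)
    (htT : (t : EReal) < T) {d R s : ℝ} (hd : 0 < d) (hs : s ∈ Ioo 0 t) :
    HasDerivAt (fun r => ∫ x in -R..R, w (t - r) x * sat d (-u r x) * bump (R ^ 2)⁻¹ x)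
      (∫ x in -R..R, (-(deriv (deriv (w (t - s))) x - 2 * f x * w (t - s) x) * sat d (-u s x) +
        w (t - s) x * (satDeriv d (-u s x) * (deriv (deriv (fun x => -u s x)) x
          - 2 * f x * (-u s x) + (-u s x) ^ 2))) * bump (R ^ 2)⁻¹ x) s := by
  have hT : ∀ r ∈ Ioo 0 t, (r : EReal) < T := fun r hr =>
    (EReal.coe_lt_coe_iff.2 hr.2).trans htT
  have hI : ∀ r ∈ Ioo 0 t, r ∈ {s : ℝ | 0 < s ∧ (s : EReal) < T} := fun r hr => ⟨hr.1, hT r hr⟩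
  have hwI : ∀ r ∈ Ioo 0 t, t - r ∈ Ioi (0 : ℝ) := fun r hr => sub_pos.2 hr.2
  have hnn : ∀ r ∈ Ioo 0 t, ∀ x, 0 ≤ -u r x := fun r hr x =>
    neg_nonneg.2 (hu0 r hr.1.le (hT r hr) x)
  have hshift : Continuous fun p : ℝ × ℝ => (t - p.1, p.2) := by fun_prop
  have hshiftI : MapsTo (fun p : ℝ × ℝ => (t - p.1, p.2)) (Ioo 0 t ×ˢ univ) (Ioi 0 ×ˢ univ) :=
    fun p hp => ⟨hwI p.1 hp.1, mem_univ _⟩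
  have hsub : Ioo 0 t ×ˢ univ ⊆ {s : ℝ | 0 < s ∧ (s : EReal) < T} ×ˢ (univ : Set ℝ) :=
    prod_mono hI le_rfl
  have cw := (hw.isC12On.continuousOn isOpen_Ioi).comp hshift.continuousOn hshiftI
  have cwt := hw.isC12On.continuousOn_time_deriv.comp hshift.continuousOn hshiftI
  have cu := ((hu.isC12On.continuousOn (isOpen_time_interval T)).mono hsub).neg
  have cut := (hu.isC12On.continuousOn_time_deriv.mono hsub).neg
  have cG := (continuousOn_sat hd).comp cu (fun p hp => hnn p.1 hp.1 p.2)
  have cG1 := (continuousOn_satDeriv hd).comp cu (fun p hp => hnn p.1 hp.1 p.2)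
  have cb : ContinuousOn (fun p : ℝ × ℝ => bump (R ^ 2)⁻¹ p.2) (Ioo 0 t ×ˢ univ) :=
    ((continuous_bump _).comp continuous_snd).continuousOn
  have key := hasDerivAt_intervalIntegral_of_continuousOn_prod isOpen_Ioo
    (g := fun r x => w (t - r) x * sat d (-u r x) * bump (R ^ 2)⁻¹ x)
    (g' := fun r x => (-deriv (fun r => w r x) (t - r) * sat d (-u r x) +
      w (t - r) x * (satDeriv d (-u r x) * -deriv (fun r => u r x) r)) * bump (R ^ 2)⁻¹ x)
    (a := -R) (b := R) (s := s) (I := Ioo 0 t) hs ?_ ?_ ?_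
  · refine key.congr_deriv (intervalIntegral.integral_congr fun x _ => ?_)
    have e1 : deriv (deriv fun x => -u s x) x = -deriv (deriv (u s)) x := by
      rw [show (deriv fun x => -u s x) = fun x => -deriv (u s) x from funext fun y => deriv.fun_neg]
      exact deriv.fun_neg
    simp only [hw.equation (t - s) (hwI s hs) x, hu.equation s hs.1 (hT s hs) x, e1]
    ring
  · intro r hr
    exact ((hw.isC12On.continuous_space (hwI r hr)).mul
      ((continuousOn_sat hd).comp_continuous (hu.isC12On.continuous_space (hI r hr)).neg
        (hnn r hr))).mul (continuous_bump _)
  · intro r hr x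
    have hk : 1 + d * -u r x ≠ 0 := by have := hnn r hr x; positivity
    have d1 : HasDerivAt (fun r => w (t - r) x) (-deriv (fun r => w r x) (t - r)) r :=
      (hw.isC12On.differentiable_time (t - r) (hwI r hr) x).hasDerivAt.comp_const_sub t r
    have d2 : HasDerivAt (fun r => sat d (-u r x))
        (satDeriv d (-u r x) * -deriv (fun r => u r x) r) r :=
      (hasDerivAt_sat hk).comp (h := fun r => -u r x) r (hu.isC12On.differentiable_time r (hI r hr) x).hasDerivAt.fun_neg
    exact (d1.fun_mul d2).mul_const _
  · exact ((cwt.neg.mul cG).add (cw.mul (cG1.mul cut))).mul cb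

/-- The time `0` is included, where `u` is only continuous and the initial value enters; `t` is
excluded because `w` is uncontrolled at time `0`. -/
theorem continuousOn_pairing (hu : IsClassicalSolution f h T u)
    (hu0 : ∀ s : ℝ, 0 ≤ s → (s : EReal) < T → ∀ x, u s x ≤ 0) (hw : IsLinearSolution f w)
    (htT : (t : EReal) < T) {d R : ℝ} (hd : 0 < d) :
    ContinuousOn (fun r => ∫ x in -R..R, w (t - r) x * sat d (-u r x) * bump (R ^ 2)⁻¹ x)
      (Ico 0 t) := by
  refine continuousOn_intervalIntegral_of_continuousOn_prod
    (g := fun r x => w (t - r) x * sat d (-u r x) * bump (R ^ 2)⁻¹ x) ?_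
  have hT : ∀ r ∈ Ico 0 t, (r : EReal) < T := fun r hr =>
    (EReal.coe_lt_coe_iff.2 hr.2).trans htT
  have hshift : Continuous fun p : ℝ × ℝ => (t - p.1, p.2) := by fun_prop
  have cw := (hw.isC12On.continuousOn isOpen_Ioi).comp hshift.continuousOn
    (fun p (hp : p ∈ Ico 0 t ×ˢ (univ : Set ℝ)) => ⟨sub_pos.2 hp.1.2, mem_univ _⟩)
  have cu := (hu.continuousOn.mono (prod_mono (fun r (hr : r ∈ Ico 0 t) => ⟨hr.1, hT r hr⟩)
    (le_refl univ))).neg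
  exact (cw.mul ((continuousOn_sat hd).comp cu
    (fun p hp => neg_nonneg.2 (hu0 p.1 hp.1.1 (hT p.1 hp.1) p.2)))).mul
      ((continuous_bump _).comp continuous_snd).continuousOn

theorem sq_div_sub_le_deriv_pairing (hf : Continuous f) (hf0 : ∀ x, 0 ≤ f x)
    (hu : IsClassicalSolution f h T u)
    (hu0 : ∀ s : ℝ, 0 ≤ s → (s : EReal) < T → ∀ x, u s x ≤ 0) (hw : IsLinearSolution f w)
    (hw0 : ∀ s, 0 < s → ∀ x, 0 ≤ w s x)
    (htT : (t : EReal) < T) {d R s : ℝ} (hd : 0 < d) (hR : 0 < R) (hs : s ∈ Ioo 0 t)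
    (hint : Integrable (w (t - s))) (hpos : 0 < ∫ x, w (t - s) x) :
    1 / (∫ x, w (t - s) x) *
        (∫ x in -R..R, w (t - s) x * sat d (-u s x) * bump (R ^ 2)⁻¹ x) ^ 2
      - 16 * (R ^ 2)⁻¹ / d * ∫ x, w (t - s) x ≤
      ∫ x in -R..R, (-(deriv (deriv (w (t - s))) x - 2 * f x * w (t - s) x) * sat d (-u s x) +
        w (t - s) x * (satDeriv d (-u s x) * (deriv (deriv (fun x => -u s x)) x
          - 2 * f x * (-u s x) + (-u s x) ^ 2))) * bump (R ^ 2)⁻¹ x := by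
  have hsT : (s : EReal) < T := (EReal.coe_lt_coe_iff.2 hs.2).trans htT
  have hI : s ∈ {s : ℝ | 0 < s ∧ (s : EReal) < T} := ⟨hs.1, hsT⟩
  have hts : 0 < t - s := sub_pos.2 hs.2
  have hnn : ∀ x, 0 ≤ -u s x := fun x => neg_nonneg.2 (hu0 s hs.1.le hsT x)
  have e1 : (deriv fun x => -u s x) = fun x => -deriv (u s) x := funext fun y => deriv.fun_neg
  have e2 : deriv (deriv fun x => -u s x) = fun x => -deriv (deriv (u s)) x := by
    rw [e1]; exact funext fun y => deriv.fun_neg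
  have hE := le_integral_sat_energy (p := w (t - s)) (q := fun x => -u s x) hf hf0
    (hw.isC12On.differentiable_space _ hts) (hw.isC12On.differentiable_space_deriv _ hts)
    (hw.isC12On.continuous_space_deriv_deriv hts) (hw0 _ hts)
    (hu.isC12On.differentiable_space s hI).neg
    (by rw [e1]; exact (hu.isC12On.differentiable_space_deriv s hI).neg)
    (by rw [e2]; exact (hu.isC12On.continuous_space_deriv_deriv hI).neg) hnn hd hR
  refine le_trans ?_ hE
  have hpc := hw.isC12On.continuous_space (s := t - s) hts
  have hG : Continuous fun x => sat d (-u s x) :=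
    (continuousOn_sat hd).comp_continuous (hu.isC12On.continuous_space hI).neg hnn
  have hb := continuous_bump (R ^ 2)⁻¹
  set m := ∫ x, w (t - s) x
  set φ := ∫ x in -R..R, w (t - s) x * sat d (-u s x) * bump (R ^ 2)⁻¹ x with hφ
  set e := (R ^ 2)⁻¹ with he
  have he0 : 0 ≤ e := by positivity
  have hmb := hw.intervalIntegral_mul_bump_le hw0 hR hts hint
  have hm : ∫ x in -R..R, w (t - s) x ≤ m := by
    rw [intervalIntegral.integral_of_le (by linarith)]
    exact setIntegral_le_integral hint (ae_of_all _ (hw0 _ hts))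
  -- Cauchy-Schwarz in linearised form: integrating `w c (G - l)² ≥ 0` bounds `∫ w c G²` below by
  -- `2lφ - l² ∫ w c`, and `l = φ/m` turns `2lφ - l² m` into `φ²/m`.
  set l := φ / m with hl
  have i1 : IntervalIntegrable (fun x => 2 * l * (w (t - s) x * sat d (-u s x) * bump e x))
    volume (-R) R := (by fun_prop : Continuous _).intervalIntegrable _ _
  have i2 : IntervalIntegrable (fun x => l ^ 2 * (w (t - s) x * bump e x))
    volume (-R) R := (by fun_prop : Continuous _).intervalIntegrable _ _
  have i3 : IntervalIntegrable (fun x => 16 * e / d * w (t - s) x)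
    volume (-R) R := (by fun_prop : Continuous _).intervalIntegrable _ _
  have h1 : 1 / m * φ ^ 2 = 2 * l * φ - l ^ 2 * m := by rw [hl]; field_simp; ring
  calc 1 / m * φ ^ 2 - 16 * e / d * m
      ≤ 2 * l * φ - l ^ 2 * (∫ x in -R..R, w (t - s) x * bump e x)
        - 16 * e / d * ∫ x in -R..R, w (t - s) x := by
        rw [h1]
        have h2 := mul_le_mul_of_nonneg_left hmb (sq_nonneg l)
        have h3 := mul_le_mul_of_nonneg_left hm (by positivity : 0 ≤ 16 * e / d)
        linarith
    _ = ∫ x in -R..R, (2 * l * (w (t - s) x * sat d (-u s x) * bump e x)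
          - l ^ 2 * (w (t - s) x * bump e x) - 16 * e / d * w (t - s) x) := by
        rw [intervalIntegral.integral_sub (i1.sub i2) i3, intervalIntegral.integral_sub i1 i2,
          intervalIntegral.integral_const_mul, intervalIntegral.integral_const_mul,
          intervalIntegral.integral_const_mul]
    _ ≤ _ := by
        refine intervalIntegral.integral_mono_on (by linarith) ((i1.sub i2).sub i3)
          ((by fun_prop : Continuous _).intervalIntegrable _ _) fun x _ => ?_
        have h4 : 0 ≤ w (t - s) x * bump e x * (sat d (-u s x) - l) ^ 2 :=
          mul_nonneg (mul_nonneg (hw0 _ hts x) (bump_nonneg e x)) (sq_nonneg _)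
        linarith

end Duality

theorem exists_forall_le_of_tendsto_cocompact {f : ℝ → ℝ} (hf : Continuous f)
    (h : Tendsto f (cocompact ℝ) (𝓝 0)) : ∃ F, ∀ x, f x ≤ F := by
  obtain ⟨C, hC⟩ := ZeroAtInftyContinuousMap.bounded (⟨⟨f, hf⟩, h⟩ : ZeroAtInftyContinuousMap ℝ ℝ)
  refine ⟨f 0 + C, fun x => ?_⟩
  have h1 : dist (f x) (f 0) ≤ C := hC x 0
  rw [Real.dist_eq] at h1
  linarith [le_abs_self (f x - f 0)]

namespace IsLinearSolution

variable {f : ℝ → ℝ} {w : ℝ → ℝ → ℝ}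

/-- The mass is nonincreasing, so its reciprocal is monotone, hence measurable, and bounded by its
value at time `t`. -/
theorem intervalIntegrable_inv_mass (hf : Continuous f) (hf0 : ∀ x, 0 ≤ f x) {F : ℝ}
    (hF : ∀ x, f x ≤ F) (hw : IsLinearSolution f w) (hw0 : ∀ s, 0 < s → ∀ x, 0 ≤ w s x) {t : ℝ}
    (ht : 0 < t) (hint : Integrable (w t)) (hpos : 0 < ∫ x, w t x) :
    IntervalIntegrable (fun s => 1 / ∫ x, w s x) volume 0 t := by
  have hanti := integral_antitone hf hf0 hF hw hw0 ht hint
  have hge : ∀ s ∈ Ioc 0 t, ∫ x, w t x ≤ ∫ x, w s x := fun s hs =>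
    hanti hs (right_mem_Ioc.2 ht) hs.2
  have hmono : MonotoneOn (fun s => 1 / ∫ x, w s x) (Ioc 0 t) := fun a ha b hb hab =>
    one_div_le_one_div_of_le (hpos.trans_le (hge b hb)) (hanti ha hb hab)
  rw [intervalIntegrable_iff_integrableOn_Ioc_of_le ht.le]
  refine IntegrableOn.of_bound (by simp)
    (aemeasurable_restrict_of_monotoneOn measurableSet_Ioc hmono).aestronglyMeasurable
    (1 / ∫ x, w t x) ?_
  refine (ae_restrict_iff' measurableSet_Ioc).2 (ae_of_all _ fun s hs => ?_)
  have h1 := hge s hs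
  rw [Real.norm_of_nonneg (one_div_nonneg.2 (hpos.le.trans h1))]
  exact one_div_le_one_div_of_le hpos h1

end IsLinearSolution

/-! ### Removing the cutoff, the saturation and the time gap -/

section Duality

variable {f h : ℝ → ℝ} {T : EReal} {u w : ℝ → ℝ → ℝ} {t : ℝ}

theorem integrable_mul_sat (hint : Integrable (w t)) (hh : Continuous h)
    (hh0 : ∀ x, h x ≤ 0) {d : ℝ} (hd : 0 < d) :
    Integrable (fun x => w t x * sat d (-h x)) := by
  have hnn : ∀ x, 0 ≤ -h x := fun x => neg_nonneg.2 (hh0 x)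
  refine hint.mul_bdd (c := d⁻¹)
    ((continuousOn_sat hd).comp_continuous hh.neg hnn).aestronglyMeasurable ?_
  refine ae_of_all _ fun x => ?_
  rw [Real.norm_of_nonneg (sat_nonneg hd (hnn x))]
  exact sat_le_inv hd (hnn x)

theorem integral_mul_sat_mul_integral_inv_mass_le (hf : Continuous f) (hf0 : ∀ x, 0 ≤ f x) {F : ℝ}
    (hF : ∀ x, f x ≤ F) (hh : Continuous h) (hu : IsClassicalSolution f h T u)
    (hu0 : ∀ s : ℝ, 0 ≤ s → (s : EReal) < T → ∀ x, u s x ≤ 0) (hw : IsLinearSolution f w)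
    (hw0 : ∀ s, 0 < s → ∀ x, 0 ≤ w s x) (ht : 0 < t) (htT : (t : EReal) < T)
    (hint : Integrable (w t)) (hpos : 0 < ∫ x, w t x) {d ε : ℝ} (hd : 0 < d) (hε : ε ∈ Ioo 0 t) :
    (∫ x, w t x * sat d (-h x)) * ∫ s in ε..t, 1 / ∫ x, w s x ≤ 1 := by
  have hT0 : ((0 : ℝ) : EReal) < T := (EReal.coe_lt_coe_iff.2 ht).trans htT
  have hh0 : ∀ x, h x ≤ 0 := fun x => by rw [← hu.initial]; exact hu0 0 le_rfl hT0 x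
  have hgi := integrable_mul_sat hint hh hh0 hd
  set a := ∫ x, w t x * sat d (-h x) with ha
  have ha0 : 0 ≤ a := integral_nonneg fun x =>
    mul_nonneg (hw0 t ht x) (sat_nonneg hd (neg_nonneg.2 (hh0 x)))
  rcases ha0.eq_or_lt with h0 | ha0
  · rw [← h0, zero_mul]; exact zero_le_one
  have hB := hw.exists_integral_le hf hf0 hF hw0 ht hint
  set K := 2 * (Real.exp ((2 * F + 5) * t) * ∫ x, w t x) with hK
  have hK0 : 0 ≤ K := by positivity
  have hanti := hw.integral_antitone hf hf0 hF hw0 ht hint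
  have hmpos : ∀ s ∈ Ioc 0 t, 0 < ∫ x, w s x := fun s hs =>
    hpos.trans_le (hanti hs (right_mem_Ioc.2 ht) hs.2)
  have hkint := hw.intervalIntegrable_inv_mass hf hf0 hF hw0 ht hint hpos
  -- The pairing is followed only up to time `t - ε`, which keeps the time argument of `w` at least
  -- `ε`.
  set r := t - ε with hr
  have hr0 : 0 ≤ r := by linarith [hε.2]
  have hsub : ∀ s ∈ Ioo 0 r, s ∈ Ioo 0 t := fun s hs => ⟨hs.1, by linarith [hs.2, hε.1]⟩
  have hrefl : ∫ s in ε..t, 1 / ∫ x, w s x = ∫ s in (0 : ℝ)..r, 1 / ∫ x, w (t - s) x := by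
    rw [intervalIntegral.integral_comp_sub_left (fun s => 1 / ∫ x, w s x) t]
    simp [hr]
  have hkr : IntegrableOn (fun s => 1 / ∫ x, w (t - s) x) (Icc 0 r) := by
    rw [← intervalIntegrable_iff_integrableOn_Icc_of_le hr0]
    have h1 : IntervalIntegrable (fun s => 1 / ∫ x, w s x) volume t ε :=
      hkint.mono_set (by
        rw [uIcc_of_ge hε.2.le, uIcc_of_le ht.le]
        exact Icc_subset_Icc_left hε.1.le)
    simpa [hr] using h1.comp_sub_left t
  have hRlim : Tendsto (fun R : ℝ => 16 * (R ^ 2)⁻¹ / d * K) atTop (𝓝 0) := by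
    have h1 : Tendsto (fun R : ℝ => (R ^ 2)⁻¹) atTop (𝓝 0) :=
      tendsto_inv_atTop_zero.comp (tendsto_pow_atTop two_ne_zero)
    simpa using ((h1.const_mul 16).div_const d).mul_const K
  have hφlim := tendsto_intervalIntegral_mul_bump hgi
  -- As `R → ∞` the initial pairing tends to `a > 0` and the error to `0`, so `a/2` can serve as the
  -- constant `c` of the Riccati lemma for all large `R`.
  have hlow : ∀ᶠ R : ℝ in atTop, a / 2 ≤
      (∫ x in -R..R, w t x * sat d (-h x) * bump (R ^ 2)⁻¹ x)
        - 16 * (R ^ 2)⁻¹ / d * K * r := by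
    have h1 := hφlim.sub (hRlim.mul_const r)
    rw [zero_mul, sub_zero] at h1
    exact h1.eventually (eventually_ge_nhds (half_lt_self ha0))
  have hineq : ∀ᶠ R : ℝ in atTop, ∫ s in (0 : ℝ)..r, 1 / ∫ x, w (t - s) x ≤
      (∫ x in -R..R, w t x * sat d (-h x) * bump (R ^ 2)⁻¹ x)⁻¹
        + 16 * (R ^ 2)⁻¹ / d * K * r / (a / 2) ^ 2 := by
    filter_upwards [hlow, eventually_gt_atTop 0] with R hRl hR
    have hφ0 : (∫ x in -R..R, w (t - 0) x * sat d (-u 0 x) * bump (R ^ 2)⁻¹ x) =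
        ∫ x in -R..R, w t x * sat d (-h x) * bump (R ^ 2)⁻¹ x := by
      simp only [sub_zero, hu.initial]
    rw [← hφ0] at hRl ⊢
    refine integral_le_inv_add_of_sq_le_deriv
      (φ := fun r => ∫ x in -R..R, w (t - r) x * sat d (-u r x) * bump (R ^ 2)⁻¹ x)
      hr0 (by positivity) (half_pos ha0)
      ((continuousOn_pairing hu hu0 hw htT hd).mono
        fun s hs => ⟨hs.1, by linarith [hs.2, hε.1]⟩)
      (fun s hs => hasDerivAt_pairing hu hu0 hw htT hd (hsub s hs))
      (fun s hs => ?_) hkr (fun s hs => ?_) hRl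
    · have hs' := hsub s hs
      exact one_div_nonneg.2 (hmpos (t - s) ⟨sub_pos.2 hs'.2, by linarith [hs'.1]⟩).le
    · have hs' := hsub s hs
      have hts : t - s ∈ Ioc 0 t := ⟨sub_pos.2 hs'.2, by linarith [hs'.1]⟩
      have h1 := sq_div_sub_le_deriv_pairing hf hf0 hu hu0 hw hw0 htT hd hR hs' (hB _ hts).1
        (hmpos _ hts)
      have h2 := mul_le_mul_of_nonneg_left (hB _ hts).2
        (by positivity : 0 ≤ 16 * (R ^ 2)⁻¹ / d)
      linarith
  have hlim2 := (hφlim.inv₀ ha0.ne').add ((hRlim.mul_const r).div_const ((a / 2) ^ 2))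
  rw [zero_mul, zero_div, add_zero] at hlim2
  have hfin := ge_of_tendsto hlim2 hineq
  rw [← ha] at hfin
  rw [hrefl]
  calc a * ∫ s in (0 : ℝ)..r, 1 / ∫ x, w (t - s) x ≤ a * a⁻¹ :=
        mul_le_mul_of_nonneg_left hfin ha0.le
    _ = 1 := mul_inv_cancel₀ ha0.ne'

theorem neg_integral_mul_le_inv (hf : Continuous f) (hf0 : ∀ x, 0 ≤ f x) {F : ℝ}
    (hF : ∀ x, f x ≤ F) (hh : Continuous h) (hu : IsClassicalSolution f h T u)
    (hu0 : ∀ s : ℝ, 0 ≤ s → (s : EReal) < T → ∀ x, u s x ≤ 0) (hw : IsLinearSolution f w)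
    (hw0 : ∀ s, 0 < s → ∀ x, 0 ≤ w s x) (ht : 0 < t) (htT : (t : EReal) < T)
    (hint : Integrable (w t)) (hpos : 0 < ∫ x, w t x) {b : ℝ} (hb : ∀ x, |h x| ≤ b)
    (hwh : Integrable fun x => w t x * h x) :
    -∫ x, w t x * h x ≤ (∫ s in (0 : ℝ)..t, 1 / ∫ x, w s x)⁻¹ := by
  have hT0 : ((0 : ℝ) : EReal) < T := (EReal.coe_lt_coe_iff.2 ht).trans htT
  have hh0 : ∀ x, h x ≤ 0 := fun x => by rw [← hu.initial]; exact hu0 0 le_rfl hT0 x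
  have hb0 : 0 ≤ b := (abs_nonneg _).trans (hb 0)
  have hkint := hw.intervalIntegrable_inv_mass hf hf0 hF hw0 ht hint hpos
  have hanti := hw.integral_antitone hf hf0 hF hw0 ht hint
  have hmpos : ∀ s ∈ Ioc 0 t, 0 < 1 / ∫ x, w s x := fun s hs =>
    one_div_pos.2 (hpos.trans_le (hanti hs (right_mem_Ioc.2 ht) hs.2))
  set k := fun s => 1 / ∫ x, w s x with hk
  have hJ : 0 < ∫ s in (0 : ℝ)..t, k s :=
    intervalIntegral.intervalIntegral_pos_of_pos_on hkint
      (fun s hs => hmpos s (Ioo_subset_Ioc_self hs)) ht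
  have hε : ∀ ε ∈ Ioo 0 t, ∀ d : ℝ, 0 < d →
      (-∫ x, w t x * h x) * (∫ s in ε..t, k s) ≤ 1 + d * b := by
    intro ε hε d hd
    have h1 := integral_mul_sat_mul_integral_inv_mass_le hf hf0 hF hh hu hu0 hw hw0 ht htT hint
      hpos hd hε
    have h2 : -∫ x, w t x * h x ≤ (1 + d * b) * ∫ x, w t x * sat d (-h x) := by
      rw [← integral_neg, ← integral_const_mul]
      refine integral_mono hwh.neg
        ((integrable_mul_sat hint hh hh0 hd).const_mul _) fun x => ?_
      have hhx : 0 ≤ -h x := neg_nonneg.2 (hh0 x)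
      -- Boundedness of the initial value makes the saturation loss explicit: `q = (1 + dq) G(q)`
      -- and `q ≤ b`.
      have h3 : -h x ≤ (1 + d * b) * sat d (-h x) := by
        unfold sat
        rw [mul_div_assoc', le_div_iff₀ (by positivity)]
        have : -h x ≤ b := (neg_le_abs _).trans (hb x)
        have := mul_le_mul_of_nonneg_left this (mul_nonneg hd.le hhx)
        linarith
      have := mul_le_mul_of_nonneg_left h3 (hw0 t ht x)
      simp only
      linarith
    have h4 : 0 ≤ ∫ s in ε..t, k s := intervalIntegral.integral_nonneg hε.2.le
      fun s hs => (hmpos s ⟨hε.1.trans_le hs.1, hs.2⟩).le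
    have h5 := mul_le_mul_of_nonneg_right h2 h4
    have h6 := mul_le_mul_of_nonneg_left h1 (by positivity : 0 ≤ 1 + d * b)
    linarith
  -- The limit `d → 0` is taken with `ε` fixed; `ε → 0` comes afterwards, by continuity of the
  -- primitive of `k`.
  have hε' : ∀ ε ∈ Ioo 0 t, (-∫ x, w t x * h x) * (∫ s in ε..t, k s) ≤ 1 := by
    intro ε hε1
    have hlim : Tendsto (fun d : ℝ => 1 + d * b) (𝓝[>] 0) (𝓝 1) := by
      have : Continuous fun d : ℝ => 1 + d * b := by fun_prop
      simpa using (this.tendsto 0).mono_left nhdsWithin_le_nhds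
    refine ge_of_tendsto hlim ?_
    filter_upwards [self_mem_nhdsWithin] with d hd using hε ε hε1 d hd
  have hc : Tendsto (fun ε => ∫ s in ε..t, k s) (𝓝[>] 0) (𝓝 (∫ s in (0 : ℝ)..t, k s)) := by
    have h1 := intervalIntegral.continuousOn_primitive_interval_left
      (f := k) (μ := volume) (a := 0) (b := t) (by
        rw [uIcc_of_le ht.le]
        exact (intervalIntegrable_iff_integrableOn_Icc_of_le ht.le).1 hkint)
    have h2 := h1 0 left_mem_uIcc
    rw [uIcc_of_le ht.le] at h2
    exact h2.mono_left (nhdsWithin_le_of_mem (mem_of_superset (Ioo_mem_nhdsGT ht)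
      Ioo_subset_Icc_self))
  have hfin : (-∫ x, w t x * h x) * (∫ s in (0 : ℝ)..t, k s) ≤ 1 := by
    refine le_of_tendsto (hc.const_mul _) ?_
    filter_upwards [Ioo_mem_nhdsGT ht] with ε hε1 using hε' ε hε1
  rwa [← one_div, le_div_iff₀ hJ]

end Duality

/-! ### The duality bound -/

theorem mainTheorem2 (f h : ℝ → ℝ)
    (hf_smooth : ContDiff ℝ ∞ f) (hf_nonneg : ∀ x, 0 ≤ f x)
    (hf_decay : Tendsto f (cocompact ℝ) (𝓝 0))
    (hf_deriv : ∃ C : ℝ, ∀ x, |deriv f x| ≤ C)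
    (hf_deriv2 : ∃ C : ℝ, ∀ x, |deriv (deriv f) x| ≤ C)
    (hh_smooth : ContDiff ℝ ∞ h)
    (T : EReal) (u : ℝ → ℝ → ℝ) (hu : IsClassicalSolution f h T u)
    (hu_nonpos : ∀ s : ℝ, 0 ≤ s → (s : EReal) < T → ∀ x, u s x ≤ 0)
    (hu_bounded : ∀ s : ℝ, 0 ≤ s → (s : EReal) < T → ∃ C : ℝ, ∀ x, |u s x| ≤ C)
    (w : ℝ → ℝ → ℝ) (hw : IsLinearSolution f w)
    (hw_nonneg : ∀ s : ℝ, 0 < s → ∀ x, 0 ≤ w s x)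
    (t : ℝ) (ht : 0 < t) (htT : (t : EReal) < T)
    (hw_int : Integrable (w t)) :
    (∀ s ∈ Ioc 0 t, Integrable (w s)) ∧
    Integrable (fun x => w t x * h x) ∧
    IntervalIntegrable (fun s => 1 / ∫ x, |w s x|) volume 0 t ∧
    -∫ x, w t x * h x ≤ (∫ s in (0 : ℝ)..t, 1 / ∫ x, |w s x|)⁻¹ := by
  have hf := hf_smooth.continuous
  have hh := hh_smooth.continuous
  obtain ⟨F, hF⟩ := exists_forall_le_of_tendsto_cocompact hf hf_decay
  obtain ⟨b, hb⟩ := hu_bounded 0 le_rfl ((EReal.coe_lt_coe_iff.2 ht).trans htT)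
  simp only [hu.initial] at hb
  have hB := hw.exists_integral_le hf hf_nonneg hF hw_nonneg ht hw_int
  have hwh : Integrable (fun x => w t x * h x) :=
    hw_int.mul_bdd hh.aestronglyMeasurable (ae_of_all _ hb)
  have habs : ∀ s ∈ Ioc 0 t, 1 / ∫ x, |w s x| = 1 / ∫ x, w s x := fun s hs => by
    simp only [abs_of_nonneg (hw_nonneg s hs.1 _)]
  have hEq : EqOn (fun s => 1 / ∫ x, w s x) (fun s => 1 / ∫ x, |w s x|) (uIoc 0 t) := by
    rw [uIoc_of_le ht.le]
    exact fun s hs => (habs s hs).symm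
  have hJ : ∫ s in (0 : ℝ)..t, 1 / ∫ x, |w s x| = ∫ s in (0 : ℝ)..t, 1 / ∫ x, w s x :=
    intervalIntegral.integral_congr_ae (ae_of_all _ fun s hs => (hEq hs).symm)
  refine ⟨fun s hs => (hB s hs).1, hwh, ?_⟩
  rw [hJ]
  -- If the mass at `t` is zero, the backward bound makes it zero on all of `(0, t]`; every quotient
  -- is then `1/0 = 0`, `w t` vanishes almost everywhere, and the inequality reads `0 ≤ 0⁻¹ = 0`.
  rcases (integral_nonneg (hw_nonneg t ht) : 0 ≤ ∫ x, w t x).eq_or_lt with h0 | hpos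
  · have hz : ∀ s ∈ uIoc 0 t, 1 / ∫ x, w s x = 0 := by
      intro s hs
      rw [uIoc_of_le ht.le] at hs
      have h1 := (hB s hs).2
      rw [← h0, mul_zero, mul_zero] at h1
      rw [h1.antisymm (integral_nonneg (hw_nonneg s hs.1)), div_zero]
    constructor
    · exact (intervalIntegrable_const (c := (0 : ℝ))).congr fun s hs =>
        (hz s hs).symm.trans (hEq hs)
    · rw [intervalIntegral.integral_congr_ae (g := fun _ => 0) (ae_of_all _ hz)]
      have hw0 := (integral_eq_zero_iff_of_nonneg (hw_nonneg t ht) hw_int).1 h0.symm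
      have : ∫ x, w t x * h x = 0 := by
        rw [← integral_zero ℝ ℝ]
        refine integral_congr_ae ?_
        filter_upwards [hw0] with x hx
        simp [hx]
      simp [this]
  · exact ⟨(hw.intervalIntegrable_inv_mass hf hf_nonneg hF hw_nonneg ht hw_int hpos).congr hEq,
      neg_integral_mul_le_inv hf hf_nonneg hF hh hu hu_nonpos hw hw_nonneg ht htT hw_int hpos hb
        hwh⟩
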